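/- For every $0<\lambda\le\Lambda$ there are constants $C_0,C_1,C_2,c_3>0$, depending only on $\lambda$ and $\Lambda$, such that the following holds. Let $k,m,n\ge 1$ be integers and let $\Sigma\in\mathbb{R}^{n\times n}$ be symmetric positive definite with $\lambda I\preceq\Sigma\preceq\Lambda I$. Let $q\in[0,1]$, $q\neq\frac12$, $\sigma\ge 0$, and put $$c=(2q-1)\sqrt{\frac{2}{\pi(\sigma^2+1)}}.$$ Let $G:\mathbb{R}^k\to\mathbb{R}^n$ be $L$-Lipschitz for the Euclidean norms, with $\|G(z)\|_1\le 1$ for all $\|z\|_2\le 1$. Let $\tau>0$, and let $x^*\in\mathbb{R}^n$ satisfy $(x^*)^{t}\Sigma x^*=1$ and be $\tau$-approximable in $\ell_1$: there is $z\in\mathbb{R}^k$ with $\|z\|_2\le 1$ and $\|c\,x^*-G(z)\|_1\le\tau$. Let $$y=\eta\odot\operatorname{sign}(Ax^*+\epsilon),$$ where $\operatorname{sign}(t)=1$ for $t\ge0$ and $-1$ for $t<0$, $\odot$ is the coordinatewise product, the rows $a_i$ of $A\in\mathbb{R}^{m\times n}$ have law $\mathcal N(0,\Sigma)$, $\mathbb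 P[\eta_i=1]=1-\mathbb P[\eta_i=-1]=q$, $\epsilon_i\sim\mathcal N(0,\sigma^2)$, and all the variables $a_i,\eta_i,\epsilon_i$ $(1\le i\le m)$ are mutually independent. If $$m\ \ge\ C_0\max\Big\{\log n,\ k\log\frac{L}{\tau}\Big\}$$ (the second entry being omitted if $L=0$), then with probability at least $1-\frac{C_2}{n^2}-e^{-c_3m/k}$, every constrained least-squares decoder $\hat x=G(\hat z)$ with $$\hat z\in\arg\min_{\|z\|_2\le 1}\frac1{2m}\|y-AG(z)\|_2^2$$ satisfies $$\|\hat x-c\,x^*\|_2\ \le\ C_1\Big(\sqrt{\tau}+\Big(\frac{\log n}{m}\Big)^{1/4}\Big).$$ -/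

import Mathlib

open MeasureTheory ProbabilityTheory Matrix

noncomputable section

namespace OneBitCS

/-- The sign convention of the model: `sgn t = 1` for `t ≥ 0` and `sgn t = -1` for `t < 0`. -/
def sgn (t : ℝ) : ℝ := if 0 ≤ t then 1 else -1

/-- The `ℓ₁`-norm of a vector of `ℝⁿ`. -/
def l1Norm {n : ℕ} (x : EuclideanSpace ℝ (Fin n)) : ℝ := ∑ i, |x i|

/-- The norm `‖x‖_Σ = (xᵗ Σ x)^{1/2}`. -/
def covNorm {n : ℕ} (S : Matrix (Fin n) (Fin n) ℝ) (x : EuclideanSpace ℝ (Fin n)) : ℝ :=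
  √(x.ofLp ⬝ᵥ S *ᵥ x.ofLp)

/-- The scaling constant `c = (2q - 1) √(2 / (π (σ² + 1)))`. -/
def scale (q σ : ℝ) : ℝ := (2 * q - 1) * √(2 / (Real.pi * (σ ^ 2 + 1)))

/-- The signals `x` such that `‖c x - G z‖₁ ≤ τ` for some `z` in the closed Euclidean ball of
radius `r`. -/
def approxRange {k n : ℕ} (G : EuclideanSpace ℝ (Fin k) → EuclideanSpace ℝ (Fin n))
    (c τ r : ℝ) : Set (EuclideanSpace ℝ (Fin n)) :=
  {x | ∃ z ∈ Metric.closedBall (0 : EuclideanSpace ℝ (Fin k)) r, l1Norm (c • x - G z) ≤ τ}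

/-- The random ingredients of the 1-bit model: a random matrix `A` with rows `a i ∼ N(0, S)`, sign
flips `η i` with `ℙ(η i = 1) = q` and `ℙ(η i = -1) = 1 - q`, and noise `ε i ∼ N(0, σ²)`.
The triples `(a i, η i, ε i)` are independent over `i`, and for each `i` the three entries of the
triple are mutually independent; so all `a i`, `η i`, `ε i` together are mutually independent. -/
structure IsOneBitModel {Ω : Type*} [MeasurableSpace Ω] (μ : Measure Ω) {m n : ℕ}
    (S : Matrix (Fin n) (Fin n) ℝ) (q σ : ℝ)
    (A : Ω → Matrix (Fin m) (Fin n) ℝ) (η ε : Ω → Fin m → ℝ) : Prop where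
  law_row : ∀ i, HasLaw (fun ω => WithLp.toLp 2 (A ω i)) (multivariateGaussian 0 S) μ
  law_noise : ∀ i, HasLaw (fun ω => ε ω i) (gaussianReal 0 (Real.toNNReal (σ ^ 2))) μ
  aemeasurable_flip : ∀ i, AEMeasurable (fun ω => η ω i) μ
  flip_pos : ∀ i, μ {ω | η ω i = 1} = ENNReal.ofReal q
  flip_neg : ∀ i, μ {ω | η ω i = -1} = ENNReal.ofReal (1 - q)
  indep_samples : iIndepFun (fun i ω => (A ω i, η ω i, ε ω i)) μ
  indep_row : ∀ i, IndepFun (fun ω => A ω i) (fun ω => (η ω i, ε ω i)) μ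
  indep_flip : ∀ i, IndepFun (fun ω => η ω i) (fun ω => ε ω i) μ

/-- The 1-bit measurements `y = η ⊙ sign (A x + ε)`. -/
def measurements {m n : ℕ} (A : Matrix (Fin m) (Fin n) ℝ) (η ε : Fin m → ℝ)
    (x : EuclideanSpace ℝ (Fin n)) : Fin m → ℝ :=
  fun i => η i * sgn ((A *ᵥ x.ofLp) i + ε i)

/-- The least squares objective `z ↦ (1 / 2m) ‖y - A G(z)‖²`. -/
def lsObjective {m n k : ℕ} (A : Matrix (Fin m) (Fin n) ℝ) (y : Fin m → ℝ)
    (G : EuclideanSpace ℝ (Fin k) → EuclideanSpace ℝ (Fin n))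
    (z : EuclideanSpace ℝ (Fin k)) : ℝ :=
  1 / (2 * (m : ℝ)) * ‖WithLp.toLp 2 (y - A *ᵥ (G z).ofLp)‖ ^ 2

/-- The set `argmin_{‖z‖₂ ≤ r} (1 / 2m) ‖y - A G(z)‖²` of constrained least squares codes. -/
def lsArgmin {m n k : ℕ} (A : Matrix (Fin m) (Fin n) ℝ) (y : Fin m → ℝ)
    (G : EuclideanSpace ℝ (Fin k) → EuclideanSpace ℝ (Fin n)) (r : ℝ) :
    Set (EuclideanSpace ℝ (Fin k)) :=
  {z | z ∈ Metric.closedBall (0 : EuclideanSpace ℝ (Fin k)) r ∧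
    IsMinOn (lsObjective A y G) (Metric.closedBall (0 : EuclideanSpace ℝ (Fin k)) r) z}

end OneBitCS

end

namespace OneBitCS

/-! Compare `u = G ẑ` with `w = G z₀`, where `z₀` approximates `v = c x`, and put `h = u - w`, `e =
v - w`, `r = y - A v`. Minimality of `ẑ` gives `‖A h‖² ≤ 2⟨A h, r⟩ + 2⟨A h, A e⟩`. Since `‖h‖₁ ≤ 2`
and `‖e‖₁ ≤ τ`, Hölder's inequality controls every error term once `AᵀA / m - S` and `Aᵀr / m` are
small entrywise. Then `lmin ‖h‖² ≲ t + τ`, where `t` is the entrywise error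
(`norm_sub_sq_le_of_residual_le`). Only `n² + n` scalar averages have to concentrate, so no net of
the range of `G` is needed.

The entries of `Aᵀr` are centred because of the choice of `c`. Here `g = ⟨a, x⟩` is standard
Gaussian, and `a_j - cov(a_j, g) g` is independent of `g`. So the correlation of `a_j` with a
measurement is `cov(a_j, g)` times a universal factor, namely `c` (`integral_mul_flip_mul_sgn_add`),
and this cancels the mean of `a_j c g`.

Each summand is dominated by squares of Gaussians, so Bernstein's inequality and a union bound give
`t` of order `√(log n / m)` off an event of probability `4 / n²`
(`IsOneBitModel.exists_concentration_event`). Taking square roots produces the exponent `1/4`. -/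

/-! ### Deterministic least squares estimates in `ℓ₁`. -/

theorem l1Norm_nonneg {n : ℕ} (x : EuclideanSpace ℝ (Fin n)) : 0 ≤ l1Norm x :=
  Finset.sum_nonneg fun _ _ => abs_nonneg _

theorem l1Norm_sub_le {n : ℕ} (x y : EuclideanSpace ℝ (Fin n)) :
    l1Norm (x - y) ≤ l1Norm x + l1Norm y := by
  unfold l1Norm
  rw [← Finset.sum_add_distrib]
  exact Finset.sum_le_sum fun i _ => abs_sub _ _

theorem norm_le_l1Norm {n : ℕ} (x : EuclideanSpace ℝ (Fin n)) : ‖x‖ ≤ l1Norm x := by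
  rw [EuclideanSpace.norm_eq]
  refine Real.sqrt_le_iff.2 ⟨l1Norm_nonneg x, ?_⟩
  unfold l1Norm
  simp only [Real.norm_eq_abs]
  exact Finset.sum_sq_le_sq_sum_of_nonneg fun i _ => abs_nonneg _

/-- Hölder's inequality between `ℓ₁` and `ℓ∞`. -/
theorem abs_dotProduct_le {n : ℕ} (x : EuclideanSpace ℝ (Fin n)) (w : Fin n → ℝ) {t : ℝ}
    (hw : ∀ j, |w j| ≤ t) : |x.ofLp ⬝ᵥ w| ≤ l1Norm x * t := by
  unfold dotProduct l1Norm
  rw [Finset.sum_mul]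
  refine (Finset.abs_sum_le_sum_abs _ _).trans (Finset.sum_le_sum fun i _ => ?_)
  rw [abs_mul]
  exact mul_le_mul_of_nonneg_left (hw i) (abs_nonneg _)

theorem abs_dotProduct_mulVec_le {n : ℕ} (x y : EuclideanSpace ℝ (Fin n))
    (M : Matrix (Fin n) (Fin n) ℝ) {t : ℝ} (hM : ∀ j l, |M j l| ≤ t) :
    |x.ofLp ⬝ᵥ M *ᵥ y.ofLp| ≤ l1Norm x * l1Norm y * t := by
  rw [mul_assoc]
  refine abs_dotProduct_le x _ fun j => ?_
  rw [mulVec, dotProduct_comm]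
  exact abs_dotProduct_le y _ (hM j)

theorem dotProduct_self_eq_norm_sq {n : ℕ} (x : EuclideanSpace ℝ (Fin n)) :
    x.ofLp ⬝ᵥ x.ofLp = ‖x‖ ^ 2 := by
  rw [EuclideanSpace.real_norm_sq_eq, dotProduct]
  exact Finset.sum_congr rfl fun i _ => (sq _).symm

/-- The least squares bound: if the empirical covariance `Aᵀ A / m` and the empirical correlation
`Aᵀ (y - A v) / m` are entrywise `t`-close to `S` and `0`, then a point of the `ℓ₁` ball with
smaller residual than a `τ`-approximation of `v` is close to it. -/
theorem norm_sub_sq_le_of_residual_le {m n : ℕ} (hm : 0 < m) {lmin b t τ : ℝ}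
    {S : Matrix (Fin n) (Fin n) ℝ} {A : Matrix (Fin m) (Fin n) ℝ} {y : Fin m → ℝ}
    {u w v : EuclideanSpace ℝ (Fin n)} (ht : 0 ≤ t) (hb : 0 ≤ b)
    (hS : ∀ v : Fin n → ℝ, lmin * (v ⬝ᵥ v) ≤ v ⬝ᵥ S *ᵥ v)
    (hSb : ∀ j l, |S j l| ≤ b)
    (hcov : ∀ j l, |(Aᵀ * A - (m : ℝ) • S) j l| ≤ m * t)
    (hcor : ∀ j, |(Aᵀ *ᵥ (y - A *ᵥ v.ofLp)) j| ≤ m * t)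
    (hu : l1Norm u ≤ 1) (hw : l1Norm w ≤ 1) (hwv : l1Norm (v - w) ≤ τ)
    (hres : ‖WithLp.toLp 2 (y - A *ᵥ u.ofLp)‖ ^ 2 ≤ ‖WithLp.toLp 2 (y - A *ᵥ w.ofLp)‖ ^ 2) :
    lmin * ‖u - w‖ ^ 2 ≤ 8 * t + 4 * τ * (b + t) := by
  have hm' : (0 : ℝ) < m := by exact_mod_cast hm
  set h := u - w with hh
  set e := v - w with he
  have hh2 : l1Norm h ≤ 2 := (l1Norm_sub_le u w).trans (by linarith)
  have h0 := l1Norm_nonneg h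
  have e0 := l1Norm_nonneg e
  rw [← dotProduct_self_eq_norm_sq, ← dotProduct_self_eq_norm_sq] at hres
  have e1 : y - A *ᵥ u.ofLp = (y - A *ᵥ v.ofLp) + A *ᵥ e.ofLp - A *ᵥ h.ofLp := by
    simp only [hh, he, WithLp.ofLp_sub, mulVec_sub]; abel
  have e2 : y - A *ᵥ w.ofLp = (y - A *ᵥ v.ofLp) + A *ᵥ e.ofLp := by
    simp only [he, WithLp.ofLp_sub, mulVec_sub]; abel
  simp only [e1, e2] at hres
  set r := y - A *ᵥ v.ofLp with hr
  -- Expand `‖r + A e - A h‖² ≤ ‖r + A e‖²`.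
  have key : (A *ᵥ h.ofLp) ⬝ᵥ (A *ᵥ h.ofLp) ≤
      2 * ((A *ᵥ h.ofLp) ⬝ᵥ r) + 2 * ((A *ᵥ h.ofLp) ⬝ᵥ (A *ᵥ e.ofLp)) := by
    have := hres
    simp only [dotProduct_sub, sub_dotProduct, dotProduct_add, add_dotProduct] at this
    rw [dotProduct_comm r (A *ᵥ h.ofLp), dotProduct_comm (A *ᵥ e.ofLp) (A *ᵥ h.ofLp)] at this
    linarith
  have quad : ∀ f : EuclideanSpace ℝ (Fin n), (A *ᵥ h.ofLp) ⬝ᵥ (A *ᵥ f.ofLp) =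
      h.ofLp ⬝ᵥ (Aᵀ * A - (m : ℝ) • S) *ᵥ f.ofLp + m * (h.ofLp ⬝ᵥ S *ᵥ f.ofLp) := by
    intro f
    rw [sub_mulVec, dotProduct_sub, smul_mulVec, dotProduct_smul, smul_eq_mul, sub_add_cancel,
      ← mulVec_mulVec, dotProduct_mulVec h.ofLp, vecMul_transpose]
  have lin : (A *ᵥ h.ofLp) ⬝ᵥ r = h.ofLp ⬝ᵥ (Aᵀ *ᵥ r) := by
    rw [dotProduct_mulVec h.ofLp, vecMul_transpose]
  rw [quad h, quad e, lin] at key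
  have b1 := (abs_le.1 (abs_dotProduct_mulVec_le h h _ hcov)).1
  have b2 := (abs_le.1 (abs_dotProduct_mulVec_le h e _ hcov)).2
  have b3 := (abs_le.1 (abs_dotProduct_mulVec_le h e _ hSb)).2
  have b4 := (abs_le.1 (abs_dotProduct_le h _ hcor)).2
  have b5 := hS h.ofLp
  rw [dotProduct_self_eq_norm_sq] at b5
  have hhh : l1Norm h * l1Norm h ≤ 4 := by nlinarith
  have hhe : l1Norm h * l1Norm e ≤ 2 * τ := mul_le_mul hh2 hwv e0 (by norm_num)
  have c1 : l1Norm h * l1Norm h * (m * t) ≤ 4 * (m * t) := by gcongr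
  have c2 : l1Norm h * l1Norm e * (m * t) ≤ 2 * τ * (m * t) := by gcongr
  have c3 : m * (l1Norm h * l1Norm e * b) ≤ m * (2 * τ * b) := by gcongr
  have c4 : l1Norm h * (m * t) ≤ 2 * (m * t) := by gcongr
  have d3 : m * (h.ofLp ⬝ᵥ S *ᵥ e.ofLp) ≤ m * (l1Norm h * l1Norm e * b) := by gcongr
  -- The quadratic and the linear errors give `4mt` each; the cross term gives `4τmt + 4τmb`.
  have fin : (m : ℝ) * (h.ofLp ⬝ᵥ S *ᵥ h.ofLp) ≤ m * (8 * t + 4 * τ * (b + t)) := by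
    linarith
  exact b5.trans (le_of_mul_le_mul_left fin hm')

/-- Entries of a matrix whose quadratic form is between `0` and `b ‖v‖²`. -/
theorem abs_apply_le_of_quadratic_le {n : ℕ} {b : ℝ} {S : Matrix (Fin n) (Fin n) ℝ}
    (hsymm : ∀ i j, S i j = S j i) (h0 : ∀ v : Fin n → ℝ, 0 ≤ v ⬝ᵥ S *ᵥ v)
    (hb : ∀ v : Fin n → ℝ, v ⬝ᵥ S *ᵥ v ≤ b * (v ⬝ᵥ v)) (j l : Fin n) : |S j l| ≤ b := by
  have diag : ∀ i, S i i ≤ b := fun i => by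
    have := hb (Pi.single i 1)
    simpa using this
  -- Nonnegativity on `e_j ± e_l` gives `2|S j l| ≤ S j j + S l l`.
  have p1 := h0 (Pi.single j 1 + Pi.single l 1)
  have p2 := h0 (Pi.single j 1 - Pi.single l 1)
  simp only [mulVec_add, mulVec_sub, dotProduct_add, dotProduct_sub, add_dotProduct,
    sub_dotProduct, single_dotProduct, mulVec_single, one_mul, MulOpposite.op_one, one_smul,
    col_apply] at p1 p2
  have := hsymm j l
  have := diag j
  have := diag l
  rw [abs_le]
  constructor <;> linarith

/-! ### Bernstein's inequality from exponential moments. -/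

/-- The second-order Taylor remainder of the exponential; for a centred variable the linear term
integrates to zero. -/
theorem exp_le_one_add_add_sq_mul_exp_abs (x : ℝ) :
    Real.exp x ≤ 1 + x + x ^ 2 * Real.exp |x| := by
  have h := Complex.norm_exp_sub_sum_le_norm_mul_exp (x : ℂ) 2
  have e : Complex.exp x - ∑ i ∈ Finset.range 2, (x : ℂ) ^ i / (Nat.factorial i : ℂ) =
      ((Real.exp x - (1 + x) : ℝ) : ℂ) := by
    simp [Finset.sum_range_succ]
  rw [e, Complex.norm_real, Complex.norm_real, Real.norm_eq_abs, Real.norm_eq_abs, sq_abs] at h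
  linarith [(abs_le.1 h).2]

/-- A centred variable with an exponential moment has a locally sub-Gaussian moment generating
function. -/
theorem mgf_le_of_integral_exp_abs_le {Ω : Type*} [MeasurableSpace Ω] {μ : Measure Ω}
    [IsProbabilityMeasure μ] {W : Ω → ℝ} {s₀ M s : ℝ} (hs₀ : 0 < s₀)
    (hW : AEMeasurable W μ) (hint : Integrable (fun ω => Real.exp (s₀ * |W ω|)) μ)
    (hM : ∫ ω, Real.exp (s₀ * |W ω|) ∂μ ≤ M) (hmean : ∫ ω, W ω ∂μ = 0) (hs : |s| ≤ s₀ / 2) :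
    Integrable (fun ω => Real.exp (s * W ω)) μ ∧
      mgf W μ s ≤ Real.exp (8 * M / s₀ ^ 2 * s ^ 2) := by
  -- Half of the exponent `s₀|w|` absorbs `w²`, by `x² ≤ 2eˣ` at `x = s₀|w|/2`; the other half
  -- absorbs `exp |s w|`.
  have hpt : ∀ w : ℝ, Real.exp (s * w) ≤
      1 + s * w + 8 / s₀ ^ 2 * s ^ 2 * Real.exp (s₀ * |w|) := by
    intro w
    refine (exp_le_one_add_add_sq_mul_exp_abs (s * w)).trans ?_
    have h1 : |s * w| ≤ s₀ / 2 * |w| := by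
      rw [abs_mul]; exact mul_le_mul_of_nonneg_right hs (abs_nonneg _)
    have h2 : (s₀ / 2 * |w|) ^ 2 ≤ 2 * Real.exp (s₀ / 2 * |w|) := by
      have := Real.quadratic_le_exp_of_nonneg (x := s₀ / 2 * |w|) (by positivity)
      have h3 : 0 ≤ s₀ / 2 * |w| := by positivity
      linarith
    have h4 : w ^ 2 ≤ 8 / s₀ ^ 2 * Real.exp (s₀ / 2 * |w|) := by
      rw [mul_pow, sq_abs, div_pow] at h2
      rw [div_mul_eq_mul_div, le_div_iff₀ (by positivity)]
      linarith
    have h5 : Real.exp (s₀ * |w|) = Real.exp (s₀ / 2 * |w|) * Real.exp (s₀ / 2 * |w|) := by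
      rw [← Real.exp_add]; ring_nf
    rw [h5]
    have h6 : (s * w) ^ 2 * Real.exp |s * w| ≤
        s ^ 2 * (8 / s₀ ^ 2 * Real.exp (s₀ / 2 * |w|)) * Real.exp (s₀ / 2 * |w|) := by
      rw [mul_pow]
      gcongr
    have h7 : s ^ 2 * (8 / s₀ ^ 2 * Real.exp (s₀ / 2 * |w|)) * Real.exp (s₀ / 2 * |w|) =
      8 / s₀ ^ 2 * s ^ 2 * (Real.exp (s₀ / 2 * |w|) * Real.exp (s₀ / 2 * |w|)) := by ring
    linarith
  have hle : ∀ w : ℝ, |w| ≤ 1 / s₀ * Real.exp (s₀ * |w|) := by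
    intro w
    rw [div_mul_eq_mul_div, one_mul, le_div_iff₀ hs₀]
    have := Real.add_one_le_exp (s₀ * |w|)
    linarith
  have hWint : Integrable W μ := by
    refine (hint.const_mul (1 / s₀)).mono' hW.aestronglyMeasurable ?_
    exact Filter.Eventually.of_forall fun ω => hle (W ω)
  have hexp : Integrable (fun ω => Real.exp (s * W ω)) μ := by
    refine hint.mono' (by fun_prop) ?_
    refine Filter.Eventually.of_forall fun ω => ?_
    rw [Real.norm_eq_abs, abs_of_pos (Real.exp_pos _)]
    refine Real.exp_le_exp.2 ((le_abs_self _).trans ?_)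
    rw [abs_mul]
    exact mul_le_mul_of_nonneg_right (by linarith) (abs_nonneg _)
  refine ⟨hexp, ?_⟩
  have h1 : mgf W μ s ≤
      ∫ ω, (1 + s * W ω + 8 / s₀ ^ 2 * s ^ 2 * Real.exp (s₀ * |W ω|)) ∂μ :=
    integral_mono hexp (((integrable_const _).add (hWint.const_mul s)).add (hint.const_mul _))
      fun ω => hpt (W ω)
  have h1' : Integrable (fun ω => 1 + s * W ω) μ := (integrable_const _).add (hWint.const_mul s)
  rw [integral_add h1' (hint.const_mul _), integral_add (integrable_const _) (hWint.const_mul s), integral_const_mul,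
    integral_const_mul, hmean] at h1
  simp only [integral_const, probReal_univ, smul_eq_mul, mul_zero, add_zero, one_mul] at h1
  refine h1.trans ?_
  have h2 : 8 / s₀ ^ 2 * s ^ 2 * ∫ ω, Real.exp (s₀ * |W ω|) ∂μ ≤ 8 / s₀ ^ 2 * s ^ 2 * M := by
    gcongr
  have h3 := Real.add_one_le_exp (8 * M / s₀ ^ 2 * s ^ 2)
  have h4 : 8 * M / s₀ ^ 2 * s ^ 2 = 8 / s₀ ^ 2 * s ^ 2 * M := by ring
  linarith

/-- Bernstein's inequality, one-sided, from a local bound on the moment generating functions. -/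
theorem measureReal_le_sum_le_of_mgf_le {Ω : Type*} [MeasurableSpace Ω] {μ : Measure Ω}
    [IsProbabilityMeasure μ] {m : ℕ} {W : Fin m → Ω → ℝ} {B r t : ℝ} (hB : 0 < B)
    (hW : ∀ i, AEMeasurable (W i) μ) (hind : iIndepFun W μ)
    (hmgf : ∀ i s, |s| ≤ r → Integrable (fun ω => Real.exp (s * W i ω)) μ ∧
      mgf (W i) μ s ≤ Real.exp (B * s ^ 2))
    (ht : 0 ≤ t) (htr : t ≤ 2 * B * r) :
    μ.real {ω | m * t ≤ ∑ i, W i ω} ≤ Real.exp (-(m * t ^ 2 / (4 * B))) := by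
  -- The minimiser of the Chernoff exponent `B s² - s t`; the bound on `t` says precisely that `s ≤
  -- r`.
  set s := t / (2 * B) with hs
  have hs0 : 0 ≤ s := by positivity
  have hsr : |s| ≤ r := by
    rw [abs_of_nonneg hs0, hs, div_le_iff₀ (by positivity)]; linarith
  have hprod := hind.mgf_sum₀ (t := s) hW Finset.univ
  have hint : Integrable (fun ω => Real.exp (s * (∑ i, W i) ω)) μ := by
    -- A non-integrable exponential would make the `mgf` of the sum the default value `0`, yet it is
    -- a product of positive factors.
    by_contra hni
    have h0 : mgf (∑ i, W i) μ s = 0 := integral_undef hni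
    rw [h0] at hprod
    have : 0 < ∏ i, mgf (W i) μ s :=
      Finset.prod_pos fun i _ => mgf_pos (hmgf i s hsr).1
    linarith
  have h := measure_ge_le_exp_mul_mgf (m * t) hs0 hint
  simp only [Finset.sum_apply] at h
  refine h.trans ?_
  rw [hprod]
  have h1 : ∏ i, mgf (W i) μ s ≤ ∏ _i : Fin m, Real.exp (B * s ^ 2) :=
    Finset.prod_le_prod (fun i _ => mgf_nonneg) fun i _ => (hmgf i s hsr).2
  rw [Finset.prod_const, Finset.card_univ, Fintype.card_fin, ← Real.exp_nat_mul] at h1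
  refine (mul_le_mul_of_nonneg_left h1 (Real.exp_pos _).le).trans ?_
  rw [← Real.exp_add]
  refine Real.exp_le_exp.2 (le_of_eq ?_)
  rw [hs]; field_simp; ring

/-- Bernstein's inequality for independent centred variables with a common exponential moment. -/
theorem measureReal_le_abs_sum_le {Ω : Type*} [MeasurableSpace Ω] {μ : Measure Ω}
    [IsProbabilityMeasure μ] {m : ℕ} {W : Fin m → Ω → ℝ} {s₀ M t : ℝ} (hs₀ : 0 < s₀) (hM : 0 < M)
    (hW : ∀ i, AEMeasurable (W i) μ) (hind : iIndepFun W μ)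
    (hint : ∀ i, Integrable (fun ω => Real.exp (s₀ * |W i ω|)) μ)
    (hbd : ∀ i, ∫ ω, Real.exp (s₀ * |W i ω|) ∂μ ≤ M) (hmean : ∀ i, ∫ ω, W i ω ∂μ = 0)
    (ht : 0 ≤ t) (htr : t ≤ 8 * M / s₀) :
    μ.real {ω | m * t ≤ |∑ i, W i ω|} ≤ 2 * Real.exp (-(m * t ^ 2 / (32 * M / s₀ ^ 2))) := by
  have hB : 0 < 8 * M / s₀ ^ 2 := by positivity
  have htr' : t ≤ 2 * (8 * M / s₀ ^ 2) * (s₀ / 2) := by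
    refine htr.trans (le_of_eq ?_); field_simp
  have h1 := measureReal_le_sum_le_of_mgf_le hB hW hind
    (fun i s hs => mgf_le_of_integral_exp_abs_le hs₀ (hW i) (hint i) (hbd i) (hmean i) hs) ht htr'
  have hind' : iIndepFun (fun i ω => -W i ω) μ :=
    hind.comp (fun _ x => -x) fun _ => measurable_neg
  have h2 := measureReal_le_sum_le_of_mgf_le (W := fun i ω => -W i ω) hB
    (fun i => (hW i).neg) hind'
    (fun i s hs => mgf_le_of_integral_exp_abs_le hs₀ (hW i).neg (by simpa using hint i)
      (by simpa using hbd i) (by rw [integral_neg, hmean i, neg_zero]) hs) ht htr'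
  have hsub : {ω | m * t ≤ |∑ i, W i ω|} ⊆
      {ω | m * t ≤ ∑ i, W i ω} ∪ {ω | m * t ≤ ∑ i, -W i ω} := by
    intro ω hω
    rcases le_abs.1 (show (m * t : ℝ) ≤ |∑ i, W i ω| from hω) with h | h
    · exact Or.inl h
    · right
      simpa [Finset.sum_neg_distrib] using h
  have h3 := (measureReal_mono hsub (μ := μ)).trans (measureReal_union_le _ _)
  have e : 4 * (8 * M / s₀ ^ 2) = 32 * M / s₀ ^ 2 := by ring
  rw [e] at h1 h2
  linarith

/-! ### Gaussian integrals and the one-bit correlation. -/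

theorem measurable_sgn : Measurable sgn :=
  Measurable.ite measurableSet_Ici measurable_const measurable_const

theorem abs_sgn (t : ℝ) : |sgn t| = 1 := by
  unfold sgn; split_ifs <;> simp

/-- Negative `b` is allowed because the Gaussian density supplies decay: this gives moments of
squares, while `b = 1/2` serves for averaging over the noise. Variance `0` is a Dirac mass. -/
theorem integrable_exp_neg_mul_sq_gaussianReal {v : NNReal} {b : ℝ} (hb : 0 < 1 + 2 * b * v) :
    Integrable (fun x => Real.exp (-b * x ^ 2)) (gaussianReal 0 v) := by
  rcases eq_or_ne v 0 with rfl | hv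
  · rw [gaussianReal_zero_var]
    exact integrable_dirac (by simp)
  have hv' : (0 : ℝ) < v := by positivity
  rw [gaussianReal_of_var_ne_zero _ hv, gaussianPDF_def,
    integrable_withDensity_iff_integrable_smul₀' (by fun_prop) (by simp)]
  have hb' : 0 < b + 1 / (2 * v) := by
    have : b + 1 / (2 * v) = (1 + 2 * b * v) / (2 * v) := by field_simp; ring
    rw [this]; positivity
  refine ((integrable_exp_neg_mul_sq hb').const_mul (√(2 * Real.pi * v))⁻¹).congr ?_
  refine Filter.Eventually.of_forall fun x => ?_
  simp only [smul_eq_mul]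
  rw [ENNReal.toReal_ofReal (gaussianPDFReal_nonneg _ _ _), gaussianPDFReal, mul_assoc _ (Real.exp _),
    ← Real.exp_add]
  congr 2
  field_simp; ring

theorem integral_exp_neg_mul_sq_gaussianReal {v : NNReal} {b : ℝ} (hb : 0 < 1 + 2 * b * v) :
    ∫ x, Real.exp (-b * x ^ 2) ∂(gaussianReal 0 v) = (√(1 + 2 * b * v))⁻¹ := by
  rcases eq_or_ne v 0 with rfl | hv
  · simp [gaussianReal_zero_var]
  have hv' : (0 : ℝ) < v := by positivity
  rw [integral_gaussianReal_eq_integral_smul hv]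
  have : ∀ x : ℝ, gaussianPDFReal 0 v x • Real.exp (-b * x ^ 2) =
      (√(2 * Real.pi * v))⁻¹ * Real.exp (-(b + 1 / (2 * v)) * x ^ 2) := by
    intro x
    rw [smul_eq_mul, gaussianPDFReal, mul_assoc, ← Real.exp_add]
    congr 2
    field_simp; ring
  simp only [this]
  rw [integral_const_mul, integral_gaussian, ← Real.sqrt_inv, ← Real.sqrt_inv,
    ← Real.sqrt_mul (by positivity)]
  congr 1
  have h2 : b + 1 / (2 * v) = (1 + 2 * b * v) / (2 * v) := by field_simp; ring
  rw [h2]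
  field_simp

/-- `E[g sign(g + e)] = 2 φ(e)` for a standard Gaussian `g` with density `φ`. -/
theorem integral_mul_sgn_add_gaussianReal (e : ℝ) :
    ∫ x, x * sgn (x + e) ∂(gaussianReal 0 1) =
      √(2 / Real.pi) * Real.exp (-(1 / 2) * e ^ 2) := by
  have hderiv : ∀ x : ℝ, HasDerivAt (fun x : ℝ => -Real.exp (-(1 / 2) * x ^ 2))
      (x * Real.exp (-(1 / 2) * x ^ 2)) x := by
    intro x
    have h := (((hasDerivAt_pow 2 x).const_mul (-(1 / 2 : ℝ))).exp).neg
    refine h.congr_deriv ?_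
    simp only [Nat.cast_ofNat]
    ring
  have hint : Integrable (fun x : ℝ => x * Real.exp (-(1 / 2) * x ^ 2)) :=
    integrable_mul_exp_neg_mul_sq (by norm_num)
  have hlim : Filter.Tendsto (fun x : ℝ => -Real.exp (-(1 / 2) * x ^ 2)) Filter.atTop
      (nhds 0) := by
    rw [← neg_zero]
    refine Filter.Tendsto.neg (Real.tendsto_exp_atBot.comp ?_)
    exact (Filter.tendsto_pow_atTop two_ne_zero).const_mul_atTop_of_neg (by norm_num)
  have hlim' : Filter.Tendsto (fun x : ℝ => -Real.exp (-(1 / 2) * x ^ 2)) Filter.atBot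
      (nhds 0) := by
    have := hlim.comp Filter.tendsto_neg_atBot_atTop
    simpa [Function.comp_def] using this
  have h1 : ∫ x in Set.Ioi (-e), x * Real.exp (-(1 / 2) * x ^ 2) =
      Real.exp (-(1 / 2) * e ^ 2) := by
    rw [integral_Ioi_of_hasDerivAt_of_tendsto' (fun x _ => hderiv x) hint.integrableOn hlim]
    simp
  have h2 : ∫ x in Set.Iic (-e), x * Real.exp (-(1 / 2) * x ^ 2) =
      -Real.exp (-(1 / 2) * e ^ 2) := by
    rw [integral_Iic_of_hasDerivAt_of_tendsto' (fun x _ => hderiv x) hint.integrableOn hlim']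
    simp
  have hpdf : ∀ x : ℝ, gaussianPDFReal 0 1 x • (x * sgn (x + e)) =
      (√(2 * Real.pi))⁻¹ * (x * Real.exp (-(1 / 2) * x ^ 2) * sgn (x + e)) := by
    intro x
    simp only [gaussianPDFReal, smul_eq_mul, NNReal.coe_one, mul_one, sub_zero]
    rw [show -x ^ 2 / 2 = -(1 / 2) * x ^ 2 by ring]
    ring
  rw [integral_gaussianReal_eq_integral_smul one_ne_zero]
  simp only [hpdf]
  rw [integral_const_mul]
  have hint' : Integrable (fun x : ℝ => x * Real.exp (-(1 / 2) * x ^ 2) * sgn (x + e)) := by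
    refine hint.mono (hint.aestronglyMeasurable.mul
      (measurable_sgn.comp (measurable_add_const e)).aestronglyMeasurable) ?_
    refine Filter.Eventually.of_forall fun x => ?_
    rw [norm_mul, Real.norm_eq_abs (sgn _), abs_sgn, mul_one]
  -- Split at `-e`, where the sign jumps; both halves contribute the same amount.
  rw [← integral_add_compl (measurableSet_Ioi (a := -e)) hint', Set.compl_Ioi]
  have h3 : ∫ x in Set.Ioi (-e), x * Real.exp (-(1 / 2) * x ^ 2) * sgn (x + e) =
      Real.exp (-(1 / 2) * e ^ 2) := by
    rw [← h1]
    refine setIntegral_congr_fun measurableSet_Ioi fun x hx => ?_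
    have : 0 ≤ x + e := by have := Set.mem_Ioi.1 hx; linarith
    simp [sgn, this]
  have h4 : ∫ x in Set.Iic (-e), x * Real.exp (-(1 / 2) * x ^ 2) * sgn (x + e) =
      Real.exp (-(1 / 2) * e ^ 2) := by
    -- The endpoint is dropped because `sgn 0 = 1`, so the integrands disagree there.
    rw [← neg_neg (Real.exp _), ← h2, ← integral_neg, integral_Iic_eq_integral_Iio,
      integral_Iic_eq_integral_Iio]
    refine setIntegral_congr_fun measurableSet_Iio fun x hx => ?_
    have : ¬ 0 ≤ x + e := by have := Set.mem_Iio.1 hx; linarith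
    simp [sgn, this]
  rw [h3, h4, ← two_mul, ← mul_assoc]
  congr 1
  rw [← Real.sqrt_inv, ← Real.sqrt_sq (show (0 : ℝ) ≤ 2 by norm_num),
    ← Real.sqrt_mul (by positivity)]
  congr 1
  rw [Real.sqrt_sq (by norm_num)]
  field_simp

/-- Gaussian regression: `E[X sign(g + e)] = cov(X, g) E[g sign(g + e)]`. -/
theorem integral_mul_sgn_add_of_hasGaussianLaw {Ω : Type*} [MeasurableSpace Ω] {μ : Measure Ω}
    [IsProbabilityMeasure μ] {X g : Ω → ℝ} (hXg : HasGaussianLaw (fun ω => (X ω, g ω)) μ)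
    (hX : ∫ ω, X ω ∂μ = 0) (hg : HasLaw g (gaussianReal 0 1) μ) (e : ℝ) :
    ∫ ω, X ω * sgn (g ω + e) ∂μ =
      cov[X, g; μ] * (√(2 / Real.pi) * Real.exp (-(1 / 2) * e ^ 2)) := by
  have hXl : HasGaussianLaw X μ := hXg.fst
  have hgl : HasGaussianLaw g μ := hXg.snd
  have hX2 : MemLp X 2 μ := hXl.memLp (by simp)
  have hg2 : MemLp g 2 μ := hgl.memLp (by simp)
  have hgm : AEMeasurable g μ := hg.aemeasurable
  have hsm : AEMeasurable (fun ω => sgn (g ω + e)) μ :=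
    measurable_sgn.comp_aemeasurable (hgm.add_const e)
  have hmean : ∫ ω, g ω ∂μ = 0 := by
    rw [hg.integral_eq]; exact integral_id_gaussianReal
  have hvar : cov[g, g; μ] = 1 := by
    rw [covariance_self hgm, hg.variance_eq, variance_id_gaussianReal]; simp
  -- As `g` has variance one, `X - β g` is uncorrelated with `g`, hence independent of it by joint
  -- Gaussianity.
  set β := cov[X, g; μ] with hβ
  have hr2 : MemLp (fun ω => X ω - β * g ω) 2 μ := hX2.sub (hg2.const_mul β)
  have hrg : HasGaussianLaw (fun ω => (X ω - β * g ω, g ω)) μ := by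
    have := hXg.map_fun (((ContinuousLinearMap.fst ℝ ℝ ℝ) - β • (ContinuousLinearMap.snd ℝ ℝ ℝ)).prod
      (ContinuousLinearMap.snd ℝ ℝ ℝ))
    simpa using this
  have hcov : cov[fun ω => X ω - β * g ω, g; μ] = 0 := by
    rw [covariance_fun_sub_left hX2 (hg2.const_mul β) hg2, covariance_const_mul_left, hvar]
    simp [hβ]
  have hind : IndepFun (fun ω => X ω - β * g ω) g μ := hrg.indepFun_of_covariance_eq_zero hcov
  have hind' : IndepFun (fun ω => X ω - β * g ω) (fun ω => sgn (g ω + e)) μ :=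
    hind.comp measurable_id (measurable_sgn.comp (measurable_add_const e))
  have hr0 : ∫ ω, (X ω - β * g ω) ∂μ = 0 := by
    rw [integral_sub (hX2.integrable (by norm_num)) ((hg2.integrable (by norm_num)).const_mul β),
      integral_const_mul, hX, hmean]; simp
  have h1 : ∫ ω, (X ω - β * g ω) * sgn (g ω + e) ∂μ = 0 := by
    rw [hind'.integral_fun_mul_eq_mul_integral hr2.aestronglyMeasurable hsm.aestronglyMeasurable,
      hr0, zero_mul]
  have hbdd : ∀ f : Ω → ℝ, MemLp f 2 μ → Integrable (fun ω => f ω * sgn (g ω + e)) μ := by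
    intro f hf
    refine (hf.integrable (by norm_num)).mono (hf.aestronglyMeasurable.mul hsm.aestronglyMeasurable)
      (Filter.Eventually.of_forall fun ω => ?_)
    rw [norm_mul, Real.norm_eq_abs (sgn _), abs_sgn, mul_one]
  have h2 : ∫ ω, g ω * sgn (g ω + e) ∂μ = √(2 / Real.pi) * Real.exp (-(1 / 2) * e ^ 2) := by
    rw [← integral_mul_sgn_add_gaussianReal, ← hg.integral_comp]
    · rfl
    · exact (measurable_id.mul (measurable_sgn.comp (measurable_add_const e))).aestronglyMeasurable
  have h3 : ∀ ω, X ω * sgn (g ω + e) =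
      (X ω - β * g ω) * sgn (g ω + e) + β * (g ω * sgn (g ω + e)) := fun ω => by ring
  simp only [h3]
  rw [integral_add (hbdd _ hr2) ((hbdd _ hg2).const_mul β), integral_const_mul, h1, h2, zero_add]

/-- The correlation of a Gaussian feature with a noisy one-bit measurement. -/
theorem integral_mul_flip_mul_sgn_add {Ω : Type*} [MeasurableSpace Ω] {μ : Measure Ω}
    [IsProbabilityMeasure μ] {X g η ε : Ω → ℝ} {q σ : ℝ}
    (hXg : HasGaussianLaw (fun ω => (X ω, g ω)) μ)
    (hX : ∫ ω, X ω ∂μ = 0) (hg : HasLaw g (gaussianReal 0 1) μ)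
    (hη : AEMeasurable η μ) (hηb : ∀ᵐ ω ∂μ, |η ω| = 1) (hηm : ∫ ω, η ω ∂μ = 2 * q - 1)
    (hε : HasLaw ε (gaussianReal 0 (Real.toNNReal (σ ^ 2))) μ)
    (hind : IndepFun (fun ω => (X ω, g ω)) (fun ω => (η ω, ε ω)) μ) (hind' : IndepFun η ε μ) :
    ∫ ω, X ω * (η ω * sgn (g ω + ε ω)) ∂μ = cov[X, g; μ] * scale q σ := by
  have hXgm : AEMeasurable (fun ω => (X ω, g ω)) μ := hXg.aemeasurable
  have hεm : AEMeasurable ε μ := hε.aemeasurable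
  have hηε : AEMeasurable (fun ω => (η ω, ε ω)) μ := hη.prodMk hεm
  have hXi : Integrable X μ := (HasGaussianLaw.memLp hXg.fst (p := 2) (by simp)).integrable
    (by norm_num)
  let F : (ℝ × ℝ) × (ℝ × ℝ) → ℝ := fun p => p.1.1 * (p.2.1 * sgn (p.1.2 + p.2.2))
  have hF : Measurable F := by
    have : Measurable fun p : (ℝ × ℝ) × (ℝ × ℝ) => sgn (p.1.2 + p.2.2) :=
      measurable_sgn.comp (by fun_prop)
    fun_prop
  have hprod := (indepFun_iff_map_prod_eq_prod_map_map hXgm hηε).1 hind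
  have hpm : AEMeasurable (fun ω => ((X ω, g ω), (η ω, ε ω))) μ := hXgm.prodMk hηε
  have hFint : Integrable F (μ.map fun ω => ((X ω, g ω), (η ω, ε ω))) := by
    rw [integrable_map_measure hF.aestronglyMeasurable hpm]
    refine hXi.mono (hF.comp_aemeasurable hpm).aestronglyMeasurable ?_
    filter_upwards [hηb] with ω hω
    simp only [F, Function.comp_apply]
    rw [norm_mul, norm_mul, Real.norm_eq_abs (sgn _), abs_sgn, Real.norm_eq_abs (η ω), hω]
    simp
  have := Measure.isProbabilityMeasure_map (μ := μ) hXgm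
  have := Measure.isProbabilityMeasure_map (μ := μ) hηε
  have h1 : ∫ ω, X ω * (η ω * sgn (g ω + ε ω)) ∂μ =
      ∫ p, F p ∂(μ.map fun ω => ((X ω, g ω), (η ω, ε ω))) :=
    (integral_map hpm hF.aestronglyMeasurable).symm
  rw [hprod] at hFint h1
  -- Fubini with the flip and the noise frozen, which reduces to a fixed shift `e`.
  rw [h1, integral_prod_symm _ hFint]
  have h2 : ∀ w : ℝ × ℝ, ∫ p, F (p, w) ∂(μ.map fun ω => (X ω, g ω)) =
      cov[X, g; μ] * √(2 / Real.pi) * (w.1 * Real.exp (-(1 / 2) * w.2 ^ 2)) := by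
    intro w
    have hFw : Measurable fun p : ℝ × ℝ => F (p, w) := hF.comp (by fun_prop)
    rw [integral_map hXgm hFw.aestronglyMeasurable]
    have h3 : ∀ ω, F ((X ω, g ω), w) = w.1 * (X ω * sgn (g ω + w.2)) := fun ω => by
      simp only [F]; ring
    simp only [h3]
    rw [integral_const_mul, integral_mul_sgn_add_of_hasGaussianLaw hXg hX hg]
    ring
  simp only [h2]
  rw [integral_const_mul, integral_map hηε (Measurable.aestronglyMeasurable (by fun_prop))]
  have hind2 : IndepFun η (fun ω => Real.exp (-(1 / 2) * ε ω ^ 2)) μ :=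
    hind'.comp (φ := id) (ψ := fun x : ℝ => Real.exp (-(1 / 2) * x ^ 2)) measurable_id
      (by fun_prop)
  rw [hind2.integral_fun_mul_eq_mul_integral hη.aestronglyMeasurable
    (AEMeasurable.aestronglyMeasurable (by fun_prop)), hηm]
  have h4 : ∫ ω, Real.exp (-(1 / 2) * ε ω ^ 2) ∂μ = (√(1 + σ ^ 2))⁻¹ := by
    have h5 := hε.integral_comp (f := fun x : ℝ => Real.exp (-(1 / 2) * x ^ 2))
      (Measurable.aestronglyMeasurable (by fun_prop))
    rw [integral_exp_neg_mul_sq_gaussianReal (by positivity)] at h5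
    simp only [Function.comp_def] at h5
    rw [h5, Real.coe_toNNReal _ (sq_nonneg σ)]
    norm_num
  rw [h4, scale, show (2 : ℝ) / (Real.pi * (σ ^ 2 + 1)) = 2 / Real.pi * (1 + σ ^ 2)⁻¹ by
    field_simp; ring, Real.sqrt_mul (by positivity), Real.sqrt_inv]
  ring

/-- A variable dominated by two squared Gaussians has an exponential moment. -/
theorem integral_exp_abs_le_two {Ω : Type*} [MeasurableSpace Ω] {μ : Measure Ω}
    [IsProbabilityMeasure μ] {a b W : Ω → ℝ} {va vb : NNReal} {V : ℝ} (hV : 0 < V)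
    (ha : HasLaw a (gaussianReal 0 va) μ) (hb : HasLaw b (gaussianReal 0 vb) μ)
    (hva : va ≤ V) (hvb : vb ≤ V) (hW : AEMeasurable W μ)
    (hbd : ∀ᵐ ω ∂μ, |W ω| ≤ V + a ω ^ 2 + b ω ^ 2) :
    Integrable (fun ω => Real.exp (1 / (8 * V) * |W ω|)) μ ∧
      ∫ ω, Real.exp (1 / (8 * V) * |W ω|) ∂μ ≤ 2 := by
  -- With `b = -1/(4V)` one has `1 + 2bv ≥ 1/2`, whence the bound `√2`.
  have key : ∀ (v : NNReal) (X : Ω → ℝ), v ≤ V → HasLaw X (gaussianReal 0 v) μ →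
      Integrable (fun ω => Real.exp (1 / (4 * V) * X ω ^ 2)) μ ∧
        ∫ ω, Real.exp (1 / (4 * V) * X ω ^ 2) ∂μ ≤ √2 := by
    intro v X hv hX
    have h1 : (1 : ℝ) / 2 ≤ 1 + 2 * (-(1 / (4 * V))) * v := by
      have : 2 * (1 / (4 * V)) * v ≤ 1 / 2 := by
        rw [mul_one_div, div_mul_eq_mul_div, div_le_div_iff₀ (by positivity) (by norm_num)]
        linarith
      linarith
    have hm : AEStronglyMeasurable (fun x : ℝ => Real.exp (-(-(1 / (4 * V))) * x ^ 2))
        (gaussianReal 0 v) := Measurable.aestronglyMeasurable (by fun_prop)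
    have hi := integrable_exp_neg_mul_sq_gaussianReal (v := v) (b := -(1 / (4 * V))) (by linarith)
    have he := integral_exp_neg_mul_sq_gaussianReal (v := v) (b := -(1 / (4 * V))) (by linarith)
    rw [← hX.integral_comp hm] at he
    rw [← hX.map_eq] at hi hm
    rw [integrable_map_measure hm hX.aemeasurable] at hi
    simp only [neg_neg, Function.comp_def] at hi he
    refine ⟨hi, he.le.trans ?_⟩
    rw [← Real.sqrt_inv]
    refine Real.sqrt_le_sqrt ?_
    rw [inv_le_comm₀ (by linarith) (by norm_num)]
    linarith
  obtain ⟨ia, ea⟩ := key va a hva ha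
  obtain ⟨ib, eb⟩ := key vb b hvb hb
  -- The inequality `2 eᵖ eʳ ≤ e²ᵖ + e²ʳ` separates the two Gaussians, so nothing is needed about
  -- their joint law. The final constant is `e^{1/8} √2 ≤ (8/7)(3/2) ≤ 2`.
  have hpt : ∀ᵐ ω ∂μ, Real.exp (1 / (8 * V) * |W ω|) ≤
      Real.exp (1 / 8) / 2 * (Real.exp (1 / (4 * V) * a ω ^ 2) +
        Real.exp (1 / (4 * V) * b ω ^ 2)) := by
    filter_upwards [hbd] with ω hω
    set p := 1 / (8 * V) * a ω ^ 2 with hp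
    set r := 1 / (8 * V) * b ω ^ 2 with hr
    have e1 : 1 / (4 * V) * a ω ^ 2 = p + p := by rw [hp]; field_simp; ring
    have e2 : 1 / (4 * V) * b ω ^ 2 = r + r := by rw [hr]; field_simp; ring
    have h1 : 1 / (8 * V) * |W ω| ≤ 1 / 8 + (p + r) := by
      have := mul_le_mul_of_nonneg_left hω (by positivity : 0 ≤ 1 / (8 * V))
      refine this.trans (le_of_eq ?_)
      rw [hp, hr]; field_simp; ring
    refine (Real.exp_le_exp.2 h1).trans ?_
    rw [e1, e2, Real.exp_add, Real.exp_add p r, Real.exp_add p p, Real.exp_add r r]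
    nlinarith [sq_nonneg (Real.exp p - Real.exp r), Real.exp_pos (1 / 8)]
  have hint := (ia.add ib).const_mul (Real.exp (1 / 8) / 2)
  have hi : Integrable (fun ω => Real.exp (1 / (8 * V) * |W ω|)) μ := by
    refine hint.mono' (AEMeasurable.aestronglyMeasurable (by fun_prop)) ?_
    filter_upwards [hpt] with ω hω
    rw [Real.norm_eq_abs, abs_of_pos (Real.exp_pos _)]
    exact hω
  refine ⟨hi, (integral_mono_ae hi hint hpt).trans ?_⟩
  simp only [Pi.add_apply]
  rw [integral_const_mul, integral_add ia ib]
  have h8 : Real.exp (1 / 8) ≤ 8 / 7 := by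
    have := Real.exp_bound_div_one_sub_of_interval (x := 1 / 8) (by norm_num) (by norm_num)
    norm_num at this ⊢
    linarith
  have h2 : √2 ≤ 3 / 2 := Real.sqrt_le_iff.2 (by norm_num)
  have h0 := Real.exp_pos (1 / 8)
  nlinarith [Real.sqrt_nonneg 2]

/-! ### Linear functionals of a Gaussian row. -/

section Row

variable {Ω : Type*} [MeasurableSpace Ω] {μ : Measure Ω} {n : ℕ} {S : Matrix (Fin n) (Fin n) ℝ}
  {a : Ω → Fin n → ℝ}

theorem inner_toLp_toLp_eq_dotProduct (u v : Fin n → ℝ) :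
    inner ℝ (WithLp.toLp 2 u) (WithLp.toLp 2 v) = u ⬝ᵥ v := by
  rw [EuclideanSpace.inner_toLp_toLp, dotProduct_comm]; simp

/-- Joint Gaussianity, not just that of each marginal, is what lets the regression argument turn
zero covariance into independence. -/
theorem hasGaussianLaw_dotProduct_prodMk
    (ha : HasLaw (fun ω => WithLp.toLp 2 (a ω)) (multivariateGaussian 0 S) μ) (u v : Fin n → ℝ) :
    HasGaussianLaw (fun ω => (u ⬝ᵥ a ω, v ⬝ᵥ a ω)) μ := by
  have h := (ha.hasGaussianLaw).map_fun ((innerSL ℝ (WithLp.toLp 2 u)).prod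
    (innerSL ℝ (WithLp.toLp 2 v)))
  simpa [inner_toLp_toLp_eq_dotProduct] using h

theorem covariance_dotProduct (hS : S.PosSemidef)
    (ha : HasLaw (fun ω => WithLp.toLp 2 (a ω)) (multivariateGaussian 0 S) μ) (u v : Fin n → ℝ) :
    cov[fun ω => u ⬝ᵥ a ω, fun ω => v ⬝ᵥ a ω; μ] = u ⬝ᵥ S *ᵥ v := by
  have h := ha.covariance_fun_comp (f := fun y => inner ℝ (WithLp.toLp 2 u) y)
    (g := fun y => inner ℝ (WithLp.toLp 2 v) y) (by fun_prop) (by fun_prop)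
  rw [← covarianceBilin_apply_eq_cov IsGaussian.memLp_two_id,
    covarianceBilin_multivariateGaussian hS] at h
  simpa only [inner_toLp_toLp_eq_dotProduct] using h

theorem integral_dotProduct_eq_zero
    (ha : HasLaw (fun ω => WithLp.toLp 2 (a ω)) (multivariateGaussian 0 S) μ) (u : Fin n → ℝ) :
    ∫ ω, u ⬝ᵥ a ω ∂μ = 0 := by
  have h := ha.integral_comp (f := fun y => innerSL ℝ (WithLp.toLp 2 u) y) (by fun_prop)
  rw [ContinuousLinearMap.integral_comp_comm _ IsGaussian.integrable_fun_id,
    integral_id_multivariateGaussian, map_zero] at h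
  simpa [Function.comp_def, inner_toLp_toLp_eq_dotProduct] using h

theorem hasLaw_dotProduct (hS : S.PosSemidef)
    (ha : HasLaw (fun ω => WithLp.toLp 2 (a ω)) (multivariateGaussian 0 S) μ) (u : Fin n → ℝ) :
    HasLaw (fun ω => u ⬝ᵥ a ω) (gaussianReal 0 (u ⬝ᵥ S *ᵥ u).toNNReal) μ := by
  have hG : HasGaussianLaw (fun ω => u ⬝ᵥ a ω) μ := (hasGaussianLaw_dotProduct_prodMk ha u u).fst
  refine ⟨hG.aemeasurable, ?_⟩
  rw [hG.map_eq_gaussianReal, integral_dotProduct_eq_zero ha, ← covariance_self hG.aemeasurable,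
    covariance_dotProduct hS ha]

end Row

/-! ### The sign flips and the scaling constant. -/

/-- The two prescribed masses add up to `1`, so almost surely no other value occurs and `η` equals
twice an indicator minus one. -/
theorem ae_abs_flip_eq_one_and_integral_flip {Ω : Type*} [MeasurableSpace Ω] {μ : Measure Ω}
    [IsProbabilityMeasure μ] {η : Ω → ℝ} {q : ℝ} (hq0 : 0 ≤ q) (hq1 : q ≤ 1)
    (hη : AEMeasurable η μ) (hpos : μ {ω | η ω = 1} = ENNReal.ofReal q)
    (hneg : μ {ω | η ω = -1} = ENNReal.ofReal (1 - q)) :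
    (∀ᵐ ω ∂μ, |η ω| = 1) ∧ ∫ ω, η ω ∂μ = 2 * q - 1 := by
  have hP : NullMeasurableSet {ω | η ω = 1} μ :=
    hη.nullMeasurable (measurableSet_singleton (1 : ℝ))
  have hN : NullMeasurableSet {ω | η ω = -1} μ :=
    hη.nullMeasurable (measurableSet_singleton (-1 : ℝ))
  have hdisj : Disjoint {ω | η ω = 1} {ω | η ω = -1} := by
    rw [Set.disjoint_left]
    intro ω h1 h2
    have h1' : η ω = 1 := h1
    have h2' : η ω = -1 := h2
    linarith
  have hunion : μ ({ω | η ω = 1} ∪ {ω | η ω = -1}) = 1 := by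
    rw [measure_union₀ hN hdisj.aedisjoint, hpos, hneg, ← ENNReal.ofReal_add hq0 (by linarith)]
    simp
  have hae : ∀ᵐ ω ∂μ, ω ∈ {ω | η ω = 1} ∪ {ω | η ω = -1} :=
    (prob_compl_eq_zero_iff₀ (hP.union hN)).2 hunion
  refine ⟨?_, ?_⟩
  · filter_upwards [hae] with ω hω
    rcases hω with h | h
    · rw [show η ω = 1 from h, abs_one]
    · rw [show η ω = -1 from h, abs_neg, abs_one]
  · have heq : η =ᵐ[μ] fun ω => 2 * {ω | η ω = 1}.indicator (fun _ => (1 : ℝ)) ω - 1 := by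
      filter_upwards [hae] with ω hω
      rcases hω with h | h
      · have h' : η ω = 1 := h
        rw [Set.indicator_of_mem h, h']; norm_num
      · have h' : η ω = -1 := h
        rw [Set.indicator_of_notMem (Set.disjoint_right.1 hdisj h), h']; norm_num
    have hind : Integrable ({ω | η ω = 1}.indicator fun _ => (1 : ℝ)) μ :=
      (integrable_const _).indicator₀ hP
    rw [integral_congr_ae heq, integral_sub (hind.const_mul 2) (integrable_const _),
      integral_const_mul, integral_indicator₀ hP]
    simp [Measure.real, hpos, ENNReal.toReal_ofReal hq0]

theorem abs_scale_le_one {q : ℝ} (σ : ℝ) (hq0 : 0 ≤ q) (hq1 : q ≤ 1) : |scale q σ| ≤ 1 := by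
  have h1 : |2 * q - 1| ≤ 1 := abs_le.2 ⟨by linarith, by linarith⟩
  have h2 : √(2 / (Real.pi * (σ ^ 2 + 1))) ≤ 1 := by
    rw [Real.sqrt_le_one]
    rw [div_le_one (by positivity)]
    nlinarith [Real.pi_gt_three, sq_nonneg σ]
  rw [scale, abs_mul, abs_of_nonneg (Real.sqrt_nonneg _)]
  exact mul_le_one₀ h1 (Real.sqrt_nonneg _) h2

/-! ### Concentration of the empirical covariances and correlations. -/

namespace IsOneBitModel

variable {Ω : Type*} [MeasurableSpace Ω] {μ : Measure Ω} [IsProbabilityMeasure μ] {m n : ℕ}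
  {S : Matrix (Fin n) (Fin n) ℝ} {q σ V : ℝ} {A : Ω → Matrix (Fin m) (Fin n) ℝ}
  {η ε : Ω → Fin m → ℝ}

/-- Bernstein's inequality for sums of functions of the samples dominated by squares of linear
functionals of the rows. -/
theorem measureReal_le_abs_sum_le (h : IsOneBitModel μ S q σ A η ε) (hS : S.PosSemidef)
    (hV : 0 < V) {u v : Fin n → ℝ} (hu : u ⬝ᵥ S *ᵥ u ≤ V) (hv : v ⬝ᵥ S *ᵥ v ≤ V)
    {f : (Fin n → ℝ) × ℝ × ℝ → ℝ} (hf : Measurable f)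
    (hbd : ∀ i, ∀ᵐ ω ∂μ,
      |f (A ω i, η ω i, ε ω i)| ≤ V + (u ⬝ᵥ A ω i) ^ 2 + (v ⬝ᵥ A ω i) ^ 2)
    (hmean : ∀ i, ∫ ω, f (A ω i, η ω i, ε ω i) ∂μ = 0) {t : ℝ} (ht : 0 ≤ t) (htV : t ≤ 128 * V) :
    μ.real {ω | m * t ≤ |∑ i, f (A ω i, η ω i, ε ω i)|} ≤
      2 * Real.exp (-(m * t ^ 2 / (4096 * V ^ 2))) := by
  have hA : ∀ i, AEMeasurable (fun ω => A ω i) μ := fun i =>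
    (WithLp.measurable_ofLp 2 (Fin n → ℝ)).comp_aemeasurable (h.law_row i).aemeasurable
  have hW : ∀ i, AEMeasurable (fun ω => f (A ω i, η ω i, ε ω i)) μ := fun i =>
    hf.comp_aemeasurable ((hA i).prodMk
      ((h.aemeasurable_flip i).prodMk (h.law_noise i).aemeasurable))
  have hexp := fun i => integral_exp_abs_le_two hV (hasLaw_dotProduct hS (h.law_row i) u)
    (hasLaw_dotProduct hS (h.law_row i) v) (by rw [Real.coe_toNNReal']; exact max_le hu hV.le)
    (by rw [Real.coe_toNNReal']; exact max_le hv hV.le) (hW i) (hbd i)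
  have hind : iIndepFun (fun i ω => f (A ω i, η ω i, ε ω i)) μ :=
    h.indep_samples.comp (fun _ => f) fun _ => hf
  -- With `s₀ = 1/(8V)` and `M = 2`, the range `8M/s₀` is `128V` and the denominator `32M/s₀²` is
  -- `4096V²`.
  have hB := OneBitCS.measureReal_le_abs_sum_le (s₀ := 1 / (8 * V)) (M := 2) (t := t)
    (by positivity) two_pos hW hind (fun i => (hexp i).1) (fun i => (hexp i).2) hmean ht
    (htV.trans (le_of_eq (by field_simp; norm_num)))
  refine hB.trans (le_of_eq ?_)
  congr 4
  field_simp; norm_num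

/-- Concentration of the entries of the empirical covariance matrix. -/
theorem measureReal_covariance_entry_le (h : IsOneBitModel μ S q σ A η ε) (hS : S.PosSemidef)
    (hV : 0 < V) (hSV : ∀ j l, |S j l| ≤ V) {t : ℝ} (ht : 0 ≤ t) (htV : t ≤ 128 * V)
    (j l : Fin n) :
    μ.real {ω | m * t ≤ |((A ω)ᵀ * A ω - (m : ℝ) • S) j l|} ≤
      2 * Real.exp (-(m * t ^ 2 / (4096 * V ^ 2))) := by
  have hdiag : ∀ j, (Pi.single j 1 : Fin n → ℝ) ⬝ᵥ S *ᵥ Pi.single j 1 ≤ V := fun j => by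
    simpa using (le_abs_self _).trans (hSV j j)
  have hB := h.measureReal_le_abs_sum_le hS hV (hdiag j) (hdiag l)
    (f := fun p => p.1 j * p.1 l - S j l) (by fun_prop) (fun i => ?_) (fun i => ?_) ht htV
  · refine le_trans (le_of_eq ?_) hB
    congr 1
    ext ω
    simp [Matrix.mul_apply, Finset.sum_sub_distrib]
  · refine Filter.Eventually.of_forall fun ω => ?_
    simp only [single_dotProduct, one_mul]
    have h1 : |A ω i j * A ω i l| ≤ A ω i j ^ 2 + A ω i l ^ 2 := by
      rw [abs_le]
      constructor <;> nlinarith [sq_nonneg (A ω i j + A ω i l), sq_nonneg (A ω i j - A ω i l),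
        sq_nonneg (A ω i j), sq_nonneg (A ω i l)]
    linarith [abs_sub (A ω i j * A ω i l) (S j l), hSV j l]
  · have hcov := covariance_dotProduct hS (h.law_row i) (Pi.single j 1) (Pi.single l 1)
    have hG := hasGaussianLaw_dotProduct_prodMk (h.law_row i) (Pi.single j 1) (Pi.single l 1)
    have m1 : MemLp (fun ω => (Pi.single j 1 : Fin n → ℝ) ⬝ᵥ A ω i) 2 μ :=
      HasGaussianLaw.memLp hG.fst (by simp)
    have m2 : MemLp (fun ω => (Pi.single l 1 : Fin n → ℝ) ⬝ᵥ A ω i) 2 μ :=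
      HasGaussianLaw.memLp hG.snd (by simp)
    have hi := m1.integrable_mul m2
    rw [covariance_eq_sub m1 m2, integral_dotProduct_eq_zero (h.law_row i)] at hcov
    simp only [single_dotProduct, one_mul, zero_mul, sub_zero, mulVec_single_one,
      Matrix.col_apply, Pi.mul_def] at hcov hi
    rw [integral_sub hi (integrable_const _), hcov]
    simp

/-- Concentration of the empirical correlations of the features with the residuals of the scaled
signal. -/
theorem measureReal_correlation_entry_le (h : IsOneBitModel μ S q σ A η ε) (hS : S.PosSemidef)
    (hV : 1 ≤ V) (hSV : ∀ j l, |S j l| ≤ V) (hq0 : 0 ≤ q) (hq1 : q ≤ 1)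
    {x : EuclideanSpace ℝ (Fin n)} (hx : x.ofLp ⬝ᵥ S *ᵥ x.ofLp = 1)
    {t : ℝ} (ht : 0 ≤ t) (htV : t ≤ 128 * V) (j : Fin n) :
    μ.real {ω | m * t ≤ |((A ω)ᵀ *ᵥ (measurements (A ω) (η ω) (ε ω) x -
        A ω *ᵥ (scale q σ • x).ofLp)) j|} ≤
      2 * Real.exp (-(m * t ^ 2 / (4096 * V ^ 2))) := by
  have hV0 : 0 < V := by linarith
  have hdiag : (Pi.single j 1 : Fin n → ℝ) ⬝ᵥ S *ᵥ Pi.single j 1 ≤ V := by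
    simpa using (le_abs_self _).trans (hSV j j)
  have hc := abs_scale_le_one σ hq0 hq1
  have hflip := fun i => ae_abs_flip_eq_one_and_integral_flip hq0 hq1 (h.aemeasurable_flip i)
    (h.flip_pos i) (h.flip_neg i)
  have hf : Measurable fun p : (Fin n → ℝ) × ℝ × ℝ =>
      p.1 j * (p.2.1 * sgn (x.ofLp ⬝ᵥ p.1 + p.2.2) - scale q σ * (x.ofLp ⬝ᵥ p.1)) := by
    have h0 : Measurable fun p : (Fin n → ℝ) × ℝ × ℝ => x.ofLp ⬝ᵥ p.1 := by
      unfold dotProduct; fun_prop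
    have h1 : Measurable fun p : (Fin n → ℝ) × ℝ × ℝ => sgn (x.ofLp ⬝ᵥ p.1 + p.2.2) :=
      measurable_sgn.comp (h0.add (by fun_prop))
    fun_prop
  have hB := h.measureReal_le_abs_sum_le hS hV0 hdiag (hx.le.trans hV) hf
    (fun i => ?_) (fun i => ?_) ht htV
  · refine le_trans (le_of_eq ?_) hB
    congr 1
    ext ω
    simp only [mulVec, dotProduct, transpose_apply, Pi.sub_apply, measurements, WithLp.ofLp_smul,
      Pi.smul_apply, smul_eq_mul, Finset.mul_sum]
    simp only [mul_comm, mul_left_comm]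
  · filter_upwards [(hflip i).1] with ω hω
    simp only [single_dotProduct, one_mul]
    set a := A ω i j
    set g := x.ofLp ⬝ᵥ A ω i
    -- Then `|a|(1 + |g|) ≤ 1/2 + a² + g²/2`, which fits under the required bound since `V ≥ 1`.
    have h1 : |η ω i * sgn (g + ε ω i) - scale q σ * g| ≤ 1 + |g| := by
      refine (abs_sub _ _).trans ?_
      rw [abs_mul, hω, abs_sgn, abs_mul]
      nlinarith [abs_nonneg g]
    rw [abs_mul]
    have h2 := mul_le_mul_of_nonneg_left h1 (abs_nonneg a)
    nlinarith [sq_nonneg (|a| - 1), sq_nonneg (|a| - |g|), sq_abs a, sq_abs g]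
  · have hG := hasGaussianLaw_dotProduct_prodMk (h.law_row i) (Pi.single j 1) x.ofLp
    have hcov := covariance_dotProduct hS (h.law_row i) (Pi.single j 1) x.ofLp
    have m1 : MemLp (fun ω => (Pi.single j 1 : Fin n → ℝ) ⬝ᵥ A ω i) 2 μ :=
      HasGaussianLaw.memLp hG.fst (by simp)
    have m2 : MemLp (fun ω => x.ofLp ⬝ᵥ A ω i) 2 μ := HasGaussianLaw.memLp hG.snd (by simp)
    have hlaw := hasLaw_dotProduct hS (h.law_row i) x.ofLp
    rw [hx, Real.toNNReal_one] at hlaw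
    have hmeas : Measurable fun a : Fin n → ℝ => ((Pi.single j 1 : Fin n → ℝ) ⬝ᵥ a,
        x.ofLp ⬝ᵥ a) := by
      unfold dotProduct; fun_prop
    have hind : IndepFun (fun ω => ((Pi.single j 1 : Fin n → ℝ) ⬝ᵥ A ω i, x.ofLp ⬝ᵥ A ω i))
        (fun ω => (η ω i, ε ω i)) μ :=
      (h.indep_row i).comp hmeas measurable_id
    have hcorr := integral_mul_flip_mul_sgn_add hG (integral_dotProduct_eq_zero (h.law_row i) _)
      hlaw (h.aemeasurable_flip i) (hflip i).1 (hflip i).2 (h.law_noise i) hind (h.indep_flip i)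
    have i2 : Integrable (fun ω => (Pi.single j 1 : Fin n → ℝ) ⬝ᵥ A ω i * (x.ofLp ⬝ᵥ A ω i)) μ :=
      m1.integrable_mul m2
    have i1 : Integrable (fun ω => (Pi.single j 1 : Fin n → ℝ) ⬝ᵥ A ω i *
        (η ω i * sgn (x.ofLp ⬝ᵥ A ω i + ε ω i))) μ := by
      have hs : AEMeasurable (fun ω => sgn (x.ofLp ⬝ᵥ A ω i + ε ω i)) μ :=
        measurable_sgn.comp_aemeasurable
          (m2.aestronglyMeasurable.aemeasurable.add (h.law_noise i).aemeasurable)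
      refine (m1.integrable (by norm_num)).mono (m1.aestronglyMeasurable.mul
        ((h.aemeasurable_flip i).mul hs).aestronglyMeasurable) ?_
      filter_upwards [(hflip i).1] with ω hω
      rw [norm_mul, norm_mul, Real.norm_eq_abs (sgn _), abs_sgn, Real.norm_eq_abs (η ω i), hω]
      simp
    have hcov' := hcov
    rw [covariance_eq_sub m1 m2, integral_dotProduct_eq_zero (h.law_row i), zero_mul,
      sub_zero] at hcov'
    simp only [Pi.mul_apply] at hcov'
    have hsplit : ∀ ω, A ω i j *
        (η ω i * sgn (x.ofLp ⬝ᵥ A ω i + ε ω i) - scale q σ * (x.ofLp ⬝ᵥ A ω i)) =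
        (Pi.single j 1 : Fin n → ℝ) ⬝ᵥ A ω i * (η ω i * sgn (x.ofLp ⬝ᵥ A ω i + ε ω i)) -
        scale q σ * ((Pi.single j 1 : Fin n → ℝ) ⬝ᵥ A ω i * (x.ofLp ⬝ᵥ A ω i)) := fun ω => by
      rw [single_dotProduct]; ring
    -- Both parts have mean `cov(a_j, g) c`, so they cancel.
    simp only [hsplit]
    rw [integral_sub i1 (i2.const_mul _), integral_const_mul, hcorr, hcov, hcov']
    ring

end IsOneBitModel

/-! ### The union bound. -/

/-- The complement of a finite union of events of probability at most `p` contains a measurable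
event of probability at least `1 - |ι| p`. -/
theorem exists_measurableSet_forall_notMem {Ω ι : Type*} [MeasurableSpace Ω] {μ : Measure Ω}
    [IsProbabilityMeasure μ] [Fintype ι] (B : ι → Set Ω) {p : ℝ} (hB : ∀ i, μ.real (B i) ≤ p) :
    ∃ E : Set Ω, MeasurableSet E ∧ 1 - Fintype.card ι * p ≤ μ.real E ∧ ∀ ω ∈ E, ∀ i, ω ∉ B i := by
  -- The bad events need not be measurable, so their union is replaced by a measurable hull of equal
  -- measure.
  refine ⟨(toMeasurable μ (⋃ i, B i))ᶜ, (measurableSet_toMeasurable _ _).compl, ?_, ?_⟩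
  · rw [probReal_compl_eq_one_sub (measurableSet_toMeasurable _ _), Measure.real,
      measure_toMeasurable, ← Measure.real]
    have h1 : μ.real (⋃ i, B i) ≤ ∑ i, μ.real (B i) := measureReal_iUnion_fintype_le B
    have h2 : ∑ i, μ.real (B i) ≤ ∑ _i : ι, p := Finset.sum_le_sum fun i _ => hB i
    rw [Finset.sum_const, nsmul_eq_mul, Finset.card_univ] at h2
    linarith
  · intro ω hω i hi
    exact hω (subset_toMeasurable _ _ (Set.mem_iUnion_of_mem i hi))

/-- On an event of probability at least `1 - 4 / n²` the empirical covariances and correlations are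
uniformly close to their means. -/
theorem IsOneBitModel.exists_concentration_event {Ω : Type*} [MeasurableSpace Ω] {μ : Measure Ω}
    [IsProbabilityMeasure μ] {m n : ℕ} {S : Matrix (Fin n) (Fin n) ℝ} {q σ V : ℝ}
    {A : Ω → Matrix (Fin m) (Fin n) ℝ} {η ε : Ω → Fin m → ℝ} (h : IsOneBitModel μ S q σ A η ε)
    (hm : 0 < m) (hn : 0 < n) (hmn : Real.log n ≤ m) (hS : S.PosSemidef) (hV : 1 ≤ V)
    (hSV : ∀ j l, |S j l| ≤ V) (hq0 : 0 ≤ q) (hq1 : q ≤ 1)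
    {x : EuclideanSpace ℝ (Fin n)} (hx : x.ofLp ⬝ᵥ S *ᵥ x.ofLp = 1) :
    ∃ E : Set Ω, MeasurableSet E ∧ 1 - 4 / (n : ℝ) ^ 2 ≤ μ.real E ∧ ∀ ω ∈ E,
      (∀ j l, |((A ω)ᵀ * A ω - (m : ℝ) • S) j l| ≤ m * (128 * V * √(Real.log n / m))) ∧
      ∀ j, |((A ω)ᵀ *ᵥ (measurements (A ω) (η ω) (ε ω) x -
        A ω *ᵥ (scale q σ • x).ofLp)) j| ≤ m * (128 * V * √(Real.log n / m)) := by
  have hV0 : 0 < V := by linarith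
  have hm' : (0 : ℝ) < m := by exact_mod_cast hm
  have hn' : (1 : ℝ) ≤ n := by exact_mod_cast hn
  have hlog : 0 ≤ Real.log n := Real.log_nonneg hn'
  -- The factor `128 V` makes the Bernstein exponent `4 log n`, so each bad event has probability at
  -- most `2/n⁴`; `log n ≤ m` keeps `t` in the admissible range.
  set t := 128 * V * √(Real.log n / m) with ht
  have ht0 : 0 ≤ t := by positivity
  have htV : t ≤ 128 * V := by
    refine mul_le_of_le_one_right (by positivity) ?_
    rw [Real.sqrt_le_one, div_le_one hm']
    exact hmn
  have hp : 2 * Real.exp (-(m * t ^ 2 / (4096 * V ^ 2))) = 2 / (n : ℝ) ^ 4 := by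
    have : m * t ^ 2 / (4096 * V ^ 2) = (4 : ℕ) * Real.log n := by
      rw [ht, mul_pow, Real.sq_sqrt (by positivity)]
      field_simp; push_cast; ring
    rw [this, Real.exp_neg, Real.exp_nat_mul, Real.exp_log (by linarith)]
    rfl
  have hcov := fun j l => (h.measureReal_covariance_entry_le hS hV0 hSV ht0 htV j l).trans hp.le
  have hcor := fun j =>
    (h.measureReal_correlation_entry_le hS hV hSV hq0 hq1 hx ht0 htV j).trans hp.le
  obtain ⟨E, hE, hEp, hEω⟩ := exists_measurableSet_forall_notMem (μ := μ)
    (Sum.elim (fun jl : Fin n × Fin n =>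
        {ω | m * t ≤ |((A ω)ᵀ * A ω - (m : ℝ) • S) jl.1 jl.2|})
      (fun j : Fin n => {ω | m * t ≤ |((A ω)ᵀ *ᵥ (measurements (A ω) (η ω) (ε ω) x -
        A ω *ᵥ (scale q σ • x).ofLp)) j|}))
    (p := 2 / (n : ℝ) ^ 4) (by
      rintro (⟨j, l⟩ | j)
      · exact hcov j l
      · exact hcor j)
  refine ⟨E, hE, le_trans ?_ hEp, fun ω hω => ⟨fun j l => ?_, fun j => ?_⟩⟩
  · simp only [Fintype.card_sum, Fintype.card_prod, Fintype.card_fin, Nat.cast_add, Nat.cast_mul]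
    -- There are `n² + n ≤ 2n²` bad events.
    have : ((n : ℝ) * n + n) * (2 / (n : ℝ) ^ 4) ≤ 4 / (n : ℝ) ^ 2 := by
      rw [mul_div_assoc', div_le_div_iff₀ (by positivity) (by positivity)]
      have h2 : (n : ℝ) ≤ n ^ 2 := by nlinarith
      have h3 : (n : ℝ) * n ^ 2 ≤ n ^ 2 * n ^ 2 := by gcongr
      nlinarith
    linarith
  · exact (not_le.1 (hEω ω hω (Sum.inl (j, l)))).le
  · exact (not_le.1 (hEω ω hω (Sum.inr j))).le

end OneBitCS

/-! ### Assembly of the recovery bound. -/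

/-- The constants `C₀, C₁, C₂, c₃` depend only on bounds `lmin`, `lmax` for the spectrum of the
covariance matrix `S`. -/
theorem theorem1 (lmin lmax : ℝ) (hlmin : 0 < lmin) :
    ∃ C₀ C₁ C₂ c₃ : ℝ, 0 < C₀ ∧ 0 < C₁ ∧ 0 < C₂ ∧ 0 < c₃ ∧
      ∀ (k m n : ℕ), 0 < k → 0 < m →
      ∀ (S : Matrix (Fin n) (Fin n) ℝ), S.PosDef →
        (∀ v : Fin n → ℝ, lmin * (v ⬝ᵥ v) ≤ v ⬝ᵥ S *ᵥ v ∧ v ⬝ᵥ S *ᵥ v ≤ lmax * (v ⬝ᵥ v)) →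
      ∀ (q σ : ℝ), 0 ≤ q → q ≤ 1 → q ≠ 1 / 2 → 0 ≤ σ →
      ∀ (L : NNReal) (G : EuclideanSpace ℝ (Fin k) → EuclideanSpace ℝ (Fin n)),
        LipschitzWith L G →
        (∀ z ∈ Metric.closedBall (0 : EuclideanSpace ℝ (Fin k)) 1, OneBitCS.l1Norm (G z) ≤ 1) →
      ∀ (τ : ℝ), 0 < τ →
      ∀ (x : EuclideanSpace ℝ (Fin n)), OneBitCS.covNorm S x = 1 →
        x ∈ OneBitCS.approxRange G (OneBitCS.scale q σ) τ 1 →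
        C₀ * max (Real.log n) (k * Real.log (L / τ)) ≤ m →
      ∀ {Ω : Type*} [MeasurableSpace Ω] (μ : Measure Ω) [IsProbabilityMeasure μ]
        (A : Ω → Matrix (Fin m) (Fin n) ℝ) (η ε : Ω → Fin m → ℝ),
        OneBitCS.IsOneBitModel μ S q σ A η ε →
        ∃ E : Set Ω, MeasurableSet E ∧
          1 - C₂ / (n : ℝ) ^ 2 - Real.exp (-(c₃ * (m / k))) ≤ μ.real E ∧
          ∀ ω ∈ E,
            ∀ z ∈ OneBitCS.lsArgmin (A ω) (OneBitCS.measurements (A ω) (η ω) (ε ω) x) G 1,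
              ‖G z - OneBitCS.scale q σ • x‖
                ≤ C₁ * (√τ + (Real.log n / m) ^ (1 / 4 : ℝ)) := by
  set V := max lmax 1
  have hV : 1 ≤ V := le_max_right _ _
  have hV0 : 0 < V := by linarith
  -- The first summand of `C₁` comes from `‖G z - G z₀‖`, the others from `‖G z₀ - c x‖`.
  refine ⟨1, √(1024 * V / lmin) + 1 + √(1 / lmin), 4, 1, one_pos, by positivity, by norm_num,
    one_pos, ?_⟩
  intro k m n hk hm S hS hSq q σ hq0 hq1 _ _ L G _ hG1 τ hτ x hx hxG hmC Ω _ μ _ A η ε hmodel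
  obtain ⟨z₀, hz₀, hzτ⟩ := hxG
  have hm' : (0 : ℝ) < m := by exact_mod_cast hm
  have hxS : x.ofLp ⬝ᵥ S *ᵥ x.ofLp = 1 := Real.sqrt_eq_one.1 hx
  have hn : 0 < n := by
    rcases Nat.eq_zero_or_pos n with rfl | hn
    · simp [dotProduct] at hxS
    · exact hn
  have hlog : 0 ≤ Real.log n := Real.log_nonneg (by exact_mod_cast hn)
  have hmn : Real.log n ≤ m := (le_max_left _ _).trans (by rwa [one_mul] at hmC)
  have hSV : ∀ j l, |S j l| ≤ V := OneBitCS.abs_apply_le_of_quadratic_le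
    (fun i j => (hS.isHermitian.apply i j).symm.trans (by simp))
    (fun v => by simpa using hS.posSemidef.dotProduct_mulVec_nonneg v)
    (fun v => (hSq v).2.trans (mul_le_mul_of_nonneg_right (le_max_left _ _)
      (Finset.sum_nonneg fun i _ => mul_self_nonneg (v i))))
  obtain ⟨E, hE, hEp, hEω⟩ := hmodel.exists_concentration_event hm hn hmn hS.posSemidef hV hSV
    hq0 hq1 hxS
  refine ⟨E, hE, ?_, ?_⟩
  -- The event has probability at least `1 - 4/n²`; the exponential is only subtracted from this.
  · linarith [Real.exp_pos (-(1 * ((m : ℝ) / k)))]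
  intro ω hω z hz
  obtain ⟨hcov, hcor⟩ := hEω ω hω
  have hmin : OneBitCS.lsObjective (A ω) (OneBitCS.measurements (A ω) (η ω) (ε ω) x) G z ≤
      OneBitCS.lsObjective (A ω) (OneBitCS.measurements (A ω) (η ω) (ε ω) x) G z₀ := hz.2 hz₀
  have hres := le_of_mul_le_mul_left hmin (by positivity : 0 < 1 / (2 * (m : ℝ)))
  set t := 128 * V * √(Real.log n / m) with ht
  have hρ1 : √(Real.log n / m) ≤ 1 := by
    rw [Real.sqrt_le_one, div_le_one hm']
    exact hmn
  have ht0 : 0 ≤ t := by positivity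
  have hls := OneBitCS.norm_sub_sq_le_of_residual_le hm ht0 hV0.le (fun v => (hSq v).1) hSV hcov
    hcor (hG1 z hz.1) (hG1 z₀ hz₀) hzτ hres
  set ρ := (Real.log n / m) ^ (1 / 4 : ℝ) with hρ
  have hρ0 : 0 ≤ ρ := by positivity
  have hρ2 : √(Real.log n / m) = ρ ^ 2 := by
    rw [hρ, Real.sqrt_eq_rpow, ← Real.rpow_natCast, ← Real.rpow_mul (by positivity)]
    norm_num
  have hτ0 : 0 ≤ √τ := Real.sqrt_nonneg τ
  have hdist : ‖G z - G z₀‖ ≤ √(1024 * V / lmin) * (√τ + ρ) := by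
    refine abs_le_of_sq_le_sq' ?_ (by positivity) |>.2
    rw [mul_pow, Real.sq_sqrt (by positivity), div_mul_eq_mul_div, le_div_iff₀ hlmin, mul_comm]
    refine hls.trans ?_
    have h1 : t = 128 * V * ρ ^ 2 := by rw [ht, hρ2]
    have h2 : t ≤ 128 * V := mul_le_of_le_one_right (by positivity) hρ1
    have h3 : τ = √τ ^ 2 := (Real.sq_sqrt hτ.le).symm
    have h4 : τ * t ≤ τ * (128 * V) := by gcongr
    have h5 : 0 ≤ V * (√τ * ρ) := by positivity
    have h6 : 0 ≤ V * τ := by positivity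
    -- Since `t ≤ 128V`, the bound `8t + 4τ(V + t)` is at most `8t + 516Vτ`, and `8t = 1024Vρ²`.
    have h7 : 1024 * V * (√τ + ρ) ^ 2 = 1024 * (V * τ) + 2048 * (V * (√τ * ρ)) + 8 * t := by
      rw [h1]; nth_rw 2 [h3]; ring
    rw [h7]
    linarith
  have hapx : ‖G z₀ - OneBitCS.scale q σ • x‖ ≤ (1 + √(1 / lmin)) * √τ := by
    -- For `τ ≤ 1` the error `τ` is at most `√τ`; for larger `τ` both vectors are bounded and `√τ ≥
    -- 1` suffices.
    rcases le_total τ 1 with h1 | h1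
    · have h2 : ‖G z₀ - OneBitCS.scale q σ • x‖ ≤ τ := by
        rw [norm_sub_rev]; exact (OneBitCS.norm_le_l1Norm _).trans hzτ
      have h3 : τ ≤ √τ := by
        refine Real.le_sqrt_of_sq_le ?_
        rw [sq]; exact mul_le_of_le_one_right hτ.le h1
      have h4 : 0 ≤ √(1 / lmin) * √τ := by positivity
      linarith
    · have h2 : ‖x‖ ≤ √(1 / lmin) := by
        refine Real.le_sqrt_of_sq_le ?_
        rw [le_div_iff₀ hlmin, mul_comm, ← OneBitCS.dotProduct_self_eq_norm_sq]
        exact (hSq x.ofLp).1.trans hxS.le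
      have h3 : ‖OneBitCS.scale q σ • x‖ ≤ √(1 / lmin) := by
        rw [norm_smul, Real.norm_eq_abs]
        exact (mul_le_of_le_one_left (norm_nonneg _)
          (OneBitCS.abs_scale_le_one σ hq0 hq1)).trans h2
      have h4 : ‖G z₀‖ ≤ 1 := (OneBitCS.norm_le_l1Norm _).trans (hG1 z₀ hz₀)
      have h5 : 1 ≤ √τ := Real.one_le_sqrt.2 h1
      calc ‖G z₀ - OneBitCS.scale q σ • x‖ ≤ 1 + √(1 / lmin) :=
            (norm_sub_le _ _).trans (add_le_add h4 h3)
        _ ≤ (1 + √(1 / lmin)) * √τ := le_mul_of_one_le_right (by positivity) h5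
  have htri := norm_sub_le_norm_sub_add_norm_sub (G z) (G z₀) (OneBitCS.scale q σ • x)
  have hpos : 0 ≤ (1 + √(1 / lmin)) * ρ := by positivity
  linarith
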